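/- For $n\ge 0$ let $\mathrm{Be}_n(x)=\sum_{j=0}^n S(n,j)x^j$ be the Bell polynomials, where $S(n,j)$ are the Stirling numbers of the second kind. For a sequence $\phi=(\phi_i)_{i\ge 1}$ of real numbers let $$\mathrm{Be}_n^\phi(x)=\sum_{j=0}^n \Phi^n_{n-j}\,\mathrm{Be}_j(x),\qquad n\ge 0,$$ where $\Phi^n_i$ is the elementary symmetric function of degree $i$ of $\phi_1,\dots,\phi_n$ (with $\Phi^n_0=1$). For finite sets $U,V$ of real numbers we say that $U$ interlaces $V$ if strictly between any two consecutive elements of $U$ there is exactly one element of $V$, and either $|U|=|V|+1$, or $|U|=|V|$ and $\max U<\max V$ (the latter inequality being void if $U=V=\emptyset$). **Theorem.** Suppose that there is a positive integer $K$ such that $\phi_i=0$ for $i\ge K+1$, and that $\phi_i\notin\{-1,-2,-3,\dots\}$ for $1\le i\le K$. Then there exists $n_0$ such that for all $n\ge n_0$: 1. all (complex) zeros of $\mathrm{Be}_n^\phi$ are real and simple; 2. the set of negative zeros of $\mathrm{Be}_{n+1}^\phi$ interlaces the set of negative zeros of $\mathrm{Be}_n^\phi$; 3. the set of positive zeros of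 $\mathrm{Be}_{n+1}^\phi$ interlaces the set of positive zeros of $\mathrm{Be}_n^\phi$. -/

import Mathlib

open Polynomial

noncomputable section

/-- The `n`-th Bell (Touchard) polynomial `∑_{j=0}^n S(n,j) x^j`, with `S(n,j)` the Stirling numbers
of the second kind. -/
def bellPoly (n : ℕ) : ℝ[X] :=
  ∑ j ∈ Finset.range (n + 1), C (Nat.stirlingSecond n j : ℝ) * X ^ j

/-- The elementary symmetric function of degree `i` of `φ 1, …, φ n`. Sequences are indexed from `1`;
the value `φ 0` is never used. -/
def elemSymm (φ : ℕ → ℝ) (n i : ℕ) : ℝ :=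
  ∑ t ∈ (Finset.Icc 1 n).powersetCard i, ∏ j ∈ t, φ j

/-- The `n`-th generalized Bell polynomial associated to the sequence `φ 1, φ 2, …`. -/
def genBellPoly (φ : ℕ → ℝ) (n : ℕ) : ℝ[X] :=
  ∑ j ∈ Finset.range (n + 1), C (elemSymm φ n (n - j)) * bellPoly j

/-- Every complex zero of the real polynomial `p` is real and simple. -/
def RealSimpleZeros (p : ℝ[X]) : Prop :=
  ∀ z : ℂ, (p.map (algebraMap ℝ ℂ)).IsRoot z →
    z.im = 0 ∧ (p.map (algebraMap ℝ ℂ)).rootMultiplicity z = 1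

/-- The set of negative zeros of `p` (for `p ≠ 0`). -/
def negZeros (p : ℝ[X]) : Finset ℝ := p.roots.toFinset.filter (fun x => x < 0)

/-- The set of positive zeros of `p` (for `p ≠ 0`). -/
def posZeros (p : ℝ[X]) : Finset ℝ := p.roots.toFinset.filter (fun x => 0 < x)

/-- `U` interlaces `V`: strictly between two consecutive elements of `U` there is exactly one element
of `V`, and either `U` has one element more than `V`, or `U` and `V` have equally many elements and
`max U < max V` (a void condition if both are empty). -/
def Interlaces (U V : Finset ℝ) : Prop :=
  (∀ a ∈ U, ∀ b ∈ U, a < b → (∀ c ∈ U, ¬ (a < c ∧ c < b)) → ∃! v, v ∈ V ∧ a < v ∧ v < b) ∧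
  (U.card = V.card + 1 ∨
    (U.card = V.card ∧ ∀ (hU : U.Nonempty) (hV : V.Nonempty), U.max' hU < V.max' hV))

end

/-!
Let `T p = X (p + p')`, so that `eˣ · T p = x (eˣ p)'`. The Bell polynomials are the iterates `Tⁿ 1`,
hence by Vieta's formulas the `n`-th generalized Bell polynomial is `∏_{i ≤ n} (T + φᵢ) 1`, and
`eˣ` times it is `∑ₖ ∏_{i ≤ n} (k + φᵢ) xᵏ / k!`. With `Q = ∏_{i ≤ K} (X + φᵢ)` and `n = K + m` this
is `∑ₖ kᵐ Q(k) xᵏ / k!`. The hypothesis on `φ` says that `Q(k) ≠ 0` for `k ≥ 1`.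

The point is to find `n` distinct real zeros for large `m`. For a number `r` strictly between
`(N - 1) / N` and `N / (N + 1)`, the quantity `k rᵏ` is maximal exactly at `k = N`, so at `x = ± rᵐ`
the term with index `N` eventually dominates the series, and the sign of the polynomial there is known
(`eventually_sign_touchard`). Fix `N` larger than all `|φᵢ|`.

* Comparing the signs at such points for `N` and smaller indices gives `N` zeros in `(-rᵐ, rᵐ)`
  (`eventually_exists_inner_zeros`).
* There are `n - N` zeros in `(-∞, -rᵐ)` (`eventually_exists_outer_zeros`). For `Q = 1` the Bell
  polynomial has `m` nonpositive zeros by Rolle's theorem, and at most `N` of them lie in `[-rᵐ, 0]`,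
  where the `N`-th derivative of the series is positive. Each factor `X + φᵢ` is then added by
  applying Rolle's theorem to `(-x)^φᵢ eˣ p`, which vanishes at `-∞`. The interval between the last
  zero and `-rᵐ` contributes a further critical point, since the sign at `-rᵐ` is unchanged
  (`exists_zeros_touchardOp_add`).

So all zeros are real and simple. Passing from `n` to `n + 1` now means applying `T`, and Rolle's
theorem for `eˣ p` on both sides of the origin, together with a count of zeros, gives the interlacing
(`interlaces_touchardOp`).
-/

/-! ### The Touchard operator -/

/-- The operator `p ↦ X (p + p')`. It is `x d/dx` conjugated by multiplication with `eˣ`. -/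
noncomputable def touchardOp : Module.End ℝ ℝ[X] :=
  LinearMap.mulLeft ℝ (X : ℝ[X]) ∘ₗ (LinearMap.id + derivative)

lemma touchardOp_apply (p : ℝ[X]) : touchardOp p = X * (p + derivative p) := rfl

/-- The polynomial `Q(T) 1`, where `T = touchardOp`. Equivalently, `eˣ · touchard Q` is the
function `Q(x d/dx) eˣ = ∑ Q(k) xᵏ / k!`. -/
noncomputable def touchard (Q : ℝ[X]) : ℝ[X] := aeval touchardOp Q 1

lemma touchard_X_mul (Q : ℝ[X]) : touchard (X * Q) = touchardOp (touchard Q) := by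
  simp [touchard]

lemma touchard_X_pow_succ_mul (m : ℕ) (Q : ℝ[X]) :
    touchard (X ^ (m + 1) * Q) = touchardOp (touchard (X ^ m * Q)) := by
  rw [pow_succ', mul_assoc, touchard_X_mul]

lemma touchard_mul_X_add_C (Q : ℝ[X]) (c : ℝ) :
    touchard (Q * (X + C c)) = touchardOp (touchard Q) + C c * touchard Q := by
  rw [mul_comm Q, add_mul]
  simp [touchard, Algebra.algebraMap_eq_smul_one, smul_eq_C_mul]

lemma monic_touchardOp_add {p : ℝ[X]} (hp : p.Monic) (c : ℝ) :
    (touchardOp p + C c * p).Monic ∧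
      (touchardOp p + C c * p).natDegree = p.natDegree + 1 := by
  have h1 : (X * p).Monic := monic_X.mul hp
  have h2 : (X * p).degree = ((p.natDegree + 1 : ℕ) : WithBot ℕ) := by
    rw [degree_eq_natDegree h1.ne_zero, natDegree_X_mul hp.ne_zero]
  have h3 : (X * derivative p + C c * p).degree < (X * p).degree := by
    rw [h2]
    refine lt_of_le_of_lt (degree_le_natDegree) ?_
    rw [Nat.cast_lt, Nat.lt_succ_iff]
    refine natDegree_add_le_of_degree_le ?_ (natDegree_C_mul_le _ _)
    by_cases h0 : p.natDegree = 0
    · rw [natDegree_eq_zero] at h0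
      obtain ⟨a, rfl⟩ := h0
      simp
    · have := natDegree_derivative_lt h0
      have := natDegree_mul_le (p := X) (q := derivative p)
      rw [natDegree_X] at this
      omega
  have h4 : touchardOp p + C c * p = X * p + (X * derivative p + C c * p) := by
    rw [touchardOp_apply]; ring
  rw [h4]
  exact ⟨h1.add_of_left h3, by
    rw [natDegree_add_eq_left_of_degree_lt h3, natDegree_X_mul hp.ne_zero]⟩

lemma touchard_one : touchard 1 = 1 := by simp [touchard]

lemma monic_touchard_X_pow_mul {Q : ℝ[X]} {d : ℕ}
    (h : (touchard Q).Monic ∧ (touchard Q).natDegree = d) (m : ℕ) :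
    (touchard (X ^ m * Q)).Monic ∧ (touchard (X ^ m * Q)).natDegree = m + d := by
  induction m with
  | zero => simpa using h
  | succ m ih =>
    have := monic_touchardOp_add ih.1 0
    rw [C_0, zero_mul, add_zero, ← touchard_X_pow_succ_mul, ih.2] at this
    exact ⟨this.1, by omega⟩

lemma monic_touchard_prod (φ : ℕ → ℝ) (n : ℕ) :
    (touchard (∏ i ∈ Finset.Icc 1 n, (X + C (φ i)))).Monic ∧
      (touchard (∏ i ∈ Finset.Icc 1 n, (X + C (φ i)))).natDegree = n := by
  induction n with
  | zero => simp [touchard_one]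
  | succ n ih =>
    rw [Finset.prod_Icc_succ_top (by omega), touchard_mul_X_add_C]
    have := monic_touchardOp_add ih.1 (φ (n + 1))
    rwa [ih.2] at this

lemma touchard_X_pow_eval_zero (m : ℕ) (hm : m ≠ 0) (Q : ℝ[X]) :
    (touchard (X ^ m * Q)).eval 0 = 0 := by
  obtain ⟨k, rfl⟩ := Nat.exists_eq_succ_of_ne_zero hm
  rw [touchard_X_pow_succ_mul, touchardOp_apply]
  simp

/-! ### Generalized Bell polynomials as Touchard polynomials -/

lemma coeff_bellPoly (n k : ℕ) : (bellPoly n).coeff k = Nat.stirlingSecond n k := by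
  simp only [bellPoly, finsetSum_coeff, coeff_C_mul_X_pow]
  rcases lt_or_ge n k with h | h
  · rw [Nat.stirlingSecond_eq_zero_of_lt h]
    refine (Finset.sum_eq_zero fun j hj => ?_).trans Nat.cast_zero.symm
    rw [Finset.mem_range] at hj
    exact if_neg (by omega)
  · rw [Finset.sum_eq_single k]
    · simp
    · intro j _ hj
      exact if_neg (Ne.symm hj)
    · intro hk
      exact absurd (Finset.mem_range.2 (Nat.lt_succ_of_le h)) hk

lemma bellPoly_succ (n : ℕ) : bellPoly (n + 1) = touchardOp (bellPoly n) := by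
  ext k
  rw [touchardOp_apply]
  cases k with
  | zero => simp [coeff_bellPoly]
  | succ k =>
    rw [coeff_X_mul, coeff_add, coeff_derivative]
    simp only [coeff_bellPoly, Nat.stirlingSecond_succ_succ]
    push_cast
    ring

lemma bellPoly_eq_touchard (n : ℕ) : bellPoly n = touchard (X ^ n) := by
  induction n with
  | zero => simp [bellPoly, touchard]
  | succ n ih => rw [bellPoly_succ, ih, pow_succ', touchard_X_mul]

lemma genBellPoly_eq_touchard (φ : ℕ → ℝ) (n : ℕ) :
    genBellPoly φ n = touchard (∏ i ∈ Finset.Icc 1 n, (X + C (φ i))) := by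
  have h : ∏ i ∈ Finset.Icc 1 n, (X + C (φ i)) =
      ∑ j ∈ Finset.range (n + 1), C (elemSymm φ n (n - j)) * X ^ j := by
    conv_lhs => rw [as_sum_range_C_mul_X_pow (∏ i ∈ Finset.Icc 1 n, (X + C (φ i)))]
    rw [natDegree_prod_of_monic _ _ fun i _ => monic_X_add_C _]
    simp only [natDegree_X_add_C, Finset.sum_const, Nat.card_Icc, smul_eq_mul, mul_one,
      Nat.add_sub_cancel]
    refine Finset.sum_congr rfl fun j hj => ?_
    rw [Finset.prod_X_add_C_coeff _ _ (by simp at hj ⊢; omega), elemSymm]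
    simp
  rw [h]
  simp [touchard, genBellPoly, bellPoly_eq_touchard, Algebra.algebraMap_eq_smul_one, smul_eq_C_mul]

lemma genBellPoly_add (φ : ℕ → ℝ) (K m : ℕ) (hzero : ∀ i : ℕ, K + 1 ≤ i → φ i = 0) :
    genBellPoly φ (K + m) = touchard (X ^ m * ∏ i ∈ Finset.Icc 1 K, (X + C (φ i))) := by
  rw [genBellPoly_eq_touchard]
  congr 1
  induction m with
  | zero => simp
  | succ m ih =>
    rw [← add_assoc, Finset.prod_Icc_succ_top (by omega), ih, hzero _ (by omega), pow_succ]
    simp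
    ring

/-! ### Exponential generating coefficients -/

/-- The functional `p ↦ k! [xᵏ] (eˣ p)`, that is, `∑ cⱼ k (k - 1) ⋯ (k - j + 1)` for
`p = ∑ cⱼ Xʲ`. -/
noncomputable def expCoeff (k : ℕ) : ℝ[X] →ₗ[ℝ] ℝ :=
  lsum fun j => (k.descFactorial j : ℝ) • LinearMap.id

lemma expCoeff_monomial (k j : ℕ) (c : ℝ) :
    expCoeff k (monomial j c) = k.descFactorial j * c := by
  simp [expCoeff, lsum_apply]

lemma expCoeff_add_derivative (k : ℕ) (p : ℝ[X]) :
    expCoeff k (p + derivative p) = expCoeff (k + 1) p := by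
  induction p using Polynomial.induction_on' with
  | add p q hp hq =>
    simp only [map_add] at hp hq ⊢
    linarith
  | monomial j c =>
    rw [map_add, derivative_monomial]
    simp only [expCoeff_monomial]
    cases j with
    | zero => simp
    | succ j =>
      have h : ((k + 1).descFactorial (j + 1) : ℝ) =
          k.descFactorial (j + 1) + (j + 1) * k.descFactorial j := by
        rw [Nat.succ_descFactorial_succ, Nat.descFactorial_succ]
        rcases le_or_gt j k with h | h
        · push_cast [h]; ring
        · simp [Nat.descFactorial_eq_zero_iff_lt.2 h]
      rw [h]
      push_cast
      ring

lemma expCoeff_X_mul (k : ℕ) (p : ℝ[X]) :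
    expCoeff (k + 1) (X * p) = (k + 1) * expCoeff k p := by
  induction p using Polynomial.induction_on' with
  | add p q hp hq => rw [mul_add, map_add, map_add, hp, hq]; ring
  | monomial j c =>
    rw [X_mul_monomial, expCoeff_monomial, expCoeff_monomial, Nat.succ_descFactorial_succ]
    push_cast
    ring

lemma expCoeff_touchardOp (k : ℕ) (p : ℝ[X]) : expCoeff k (touchardOp p) = k * expCoeff k p := by
  rw [touchardOp_apply]
  cases k with
  | zero =>
    induction p + derivative p using Polynomial.induction_on' with
    | add p q hp hq => rw [mul_add, map_add, hp, hq]; simp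
    | monomial j c => simp [X_mul_monomial, expCoeff_monomial]
  | succ k => rw [expCoeff_X_mul, expCoeff_add_derivative]; simp

lemma expCoeff_touchard (k : ℕ) (Q : ℝ[X]) : expCoeff k (touchard Q) = Q.eval (k : ℝ) := by
  induction Q using Polynomial.induction_on with
  | C a =>
    have : touchard (C a) = monomial 0 a := by
      simp [touchard, Algebra.algebraMap_eq_smul_one, smul_eq_C_mul]
    rw [this, expCoeff_monomial]
    simp
  | add p q hp hq =>
    have : touchard (p + q) = touchard p + touchard q := by simp [touchard]
    rw [this, map_add, hp, hq, eval_add]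
  | monomial n a ih =>
    have : C a * X ^ (n + 1) = X * (C a * X ^ n) := by ring
    rw [this, touchard_X_mul, expCoeff_touchardOp, ih]
    simp

lemma hasSum_expCoeff (p : ℝ[X]) (x : ℝ) :
    HasSum (fun k : ℕ => expCoeff k p * (x ^ k / k.factorial)) (Real.exp x * p.eval x) := by
  induction p using Polynomial.induction_on' with
  | add p q hp hq => simpa [add_mul, mul_add] using hp.add hq
  | monomial j c =>
    have h : HasSum (fun k : ℕ => expCoeff (k + j) (monomial j c) *
        (x ^ (k + j) / (k + j).factorial)) (Real.exp x * (monomial j c).eval x) := by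
      have h0 := (NormedSpace.expSeries_div_hasSum_exp x).mul_right (c * x ^ j)
      rw [← Real.exp_eq_exp_ℝ] at h0
      rw [eval_monomial]
      convert! h0 using 2 with k
      have h1 := Nat.factorial_mul_descFactorial (n := k + j) (k := j) (by omega)
      rw [Nat.add_sub_cancel] at h1
      rw [expCoeff_monomial, ← h1]
      have h2 : (k.factorial : ℝ) ≠ 0 := by positivity
      have h3 : ((k + j).descFactorial j : ℝ) ≠ 0 := by
        rw [Nat.cast_ne_zero, Ne, Nat.descFactorial_eq_zero_iff_lt]; omega
      push_cast
      field_simp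
      ring
    refine (hasSum_nat_add_iff' j).1 ?_
    rw [Finset.sum_eq_zero, sub_zero]
    · exact h
    · intro i hi
      rw [expCoeff_monomial, Nat.descFactorial_eq_zero_iff_lt.2 (Finset.mem_range.1 hi)]
      simp

/-! ### Rolle's theorem for finite sets of zeros -/

open Set Filter Topology in
/-- Rolle's theorem on `(-∞, y)` for a function that vanishes at `y` and tends to `0` at `-∞`. -/
lemma exists_deriv_zero_of_tendsto_atBot {f f' : ℝ → ℝ} {y : ℝ}
    (hf : ∀ x ≤ y, HasDerivAt f (f' x) x) (h0 : f y = 0) (hlim : Tendsto f atBot (𝓝 0)) :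
    ∃ c < y, f' c = 0 := by
  by_cases hz : ∀ x < y, f x = 0
  · obtain ⟨c, hc, hc'⟩ := exists_hasDerivAt_eq_zero (f := f) (f' := f') (sub_one_lt y)
      (fun x hx => (hf x hx.2).continuousAt.continuousWithinAt)
      (by rw [h0, hz _ (sub_one_lt y)]) (fun x hx => hf x hx.2.le)
    exact ⟨c, hc.2, hc'⟩
  push Not at hz
  obtain ⟨x₀, hx₀, hne⟩ := hz
  -- The maximum of `|f|` on a large interval `[x₁, y]` is attained in the interior.
  have hsmall : ∀ᶠ x in atBot, |f x| < |f x₀| := by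
    have := hlim.abs
    rw [abs_zero] at this
    exact this.eventually_lt_const (abs_pos.2 hne)
  obtain ⟨x₁, hx₁, hx₁'⟩ := (hsmall.and (eventually_lt_atBot x₀)).exists
  obtain ⟨c, hc, hmax⟩ := (isCompact_Icc (a := x₁) (b := y)).exists_isMaxOn
    ⟨x₀, hx₁'.le, hx₀.le⟩ (f := fun x => |f x|)
    (ContinuousOn.abs fun x hx => (hf x hx.2).continuousAt.continuousWithinAt)
  have hge : |f x₀| ≤ |f c| := hmax ⟨hx₁'.le, hx₀.le⟩
  have hc1 : x₁ < c := lt_of_le_of_ne hc.1 (by rintro rfl; linarith)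
  have hc2 : c < y := lt_of_le_of_ne hc.2 (by
    rintro rfl; rw [h0, abs_zero] at hge; exact hne (abs_nonpos_iff.1 hge))
  refine ⟨c, hc2, ?_⟩
  have hnhds : Icc x₁ y ∈ 𝓝 c := Icc_mem_nhds hc1 hc2
  rcases le_total 0 (f c) with hs | hs
  · refine IsLocalMax.hasDerivAt_eq_zero ?_ (hf c hc.2)
    filter_upwards [hnhds] with x hx
    exact (le_abs_self _).trans ((hmax hx).trans (abs_of_nonneg hs).le)
  · refine IsLocalMin.hasDerivAt_eq_zero ?_ (hf c hc.2)
    filter_upwards [hnhds] with x hx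
    have h1 : |f x| ≤ |f c| := hmax hx
    rw [abs_of_nonpos hs] at h1
    linarith [neg_abs_le (f x)]

open Set in
/-- Rolle's theorem on `(a, b)` when `f a = 0` and `f²` is decreasing at `b`. -/
lemma exists_deriv_zero_of_mul_deriv_neg {f f' : ℝ → ℝ} {a b : ℝ} (hab : a < b)
    (hf : ∀ x ∈ Icc a b, HasDerivAt f (f' x) x) (ha : f a = 0) (hb : f b * f' b < 0) :
    ∃ c, a < c ∧ c < b ∧ f' c = 0 := by
  obtain ⟨ξ, hξ, hξ'⟩ := exists_hasDerivAt_eq_slope f f' hab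
    (fun x hx => (hf x hx).continuousAt.continuousWithinAt)
    (fun x hx => hf x ⟨hx.1.le, hx.2.le⟩)
  rw [ha, sub_zero] at hξ'
  have hba : 0 < b - a := sub_pos.2 hab
  have hd : ∀ x ∈ Icc ξ b, HasDerivWithinAt f (f' x) (Icc ξ b) x :=
    fun x hx => (hf x ⟨hξ.1.le.trans hx.1, hx.2⟩).hasDerivWithinAt
  rcases mul_neg_iff.1 hb with ⟨h1, h2⟩ | ⟨h1, h2⟩
  · obtain ⟨c, hc, hc'⟩ := exists_hasDerivWithinAt_eq_of_lt_of_gt hξ.2.le hd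
      (m := 0) (by rw [hξ']; exact div_pos h1 hba) h2
    exact ⟨c, hξ.1.trans hc.1, hc.2, hc'⟩
  · obtain ⟨c, hc, hc'⟩ := exists_hasDerivWithinAt_eq_of_gt_of_lt hξ.2.le hd
      (m := 0) (by rw [hξ']; exact div_neg_of_neg_of_pos h1 hba) h2
    exact ⟨c, hξ.1.trans hc.1, hc.2, hc'⟩

/-- Between the elements of a finite set `s` of zeros of `f` lie `|s| - 1` zeros of `f'`, and any two
of them are separated by an element of `s`. -/
lemma exists_finset_deriv_zeros {f f' : ℝ → ℝ} {s : Finset ℝ} (hs : s.Nonempty)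
    (hf : ∀ a ∈ s, ∀ b ∈ s, ∀ x, a ≤ x → x ≤ b → HasDerivAt f (f' x) x)
    (h0 : ∀ x ∈ s, f x = 0) :
    ∃ t : Finset ℝ, t.card + 1 = s.card ∧
      (∀ y ∈ t, f' y = 0 ∧ (∃ x ∈ s, x < y) ∧ ∃ x ∈ s, y < x) ∧
      ∀ a ∈ t, ∀ b ∈ t, a < b → ∃ v ∈ s, a < v ∧ v < b := by
  induction s using Finset.induction_on_max with
  | empty => exact absurd hs Finset.not_nonempty_empty
  | insert a s ha ih =>
    have has : a ∉ s := fun h => lt_irrefl a (ha a h)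
    rcases s.eq_empty_or_nonempty with rfl | hne
    · exact ⟨∅, by simp⟩
    obtain ⟨t, ht1, ht2, ht3⟩ := ih hne
      (fun u hu v hv => hf u (Finset.mem_insert_of_mem hu) v (Finset.mem_insert_of_mem hv))
      (fun x hx => h0 x (Finset.mem_insert_of_mem hx))
    have hm := s.max'_mem hne
    obtain ⟨c, ⟨hc1, hc2⟩, hc'⟩ := exists_hasDerivAt_eq_zero (f := f) (f' := f') (ha _ hm)
      (fun x hx => (hf _ (Finset.mem_insert_of_mem hm) a (Finset.mem_insert_self _ _) x
        hx.1 hx.2).continuousAt.continuousWithinAt)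
      (by rw [h0 _ (Finset.mem_insert_of_mem hm), h0 _ (Finset.mem_insert_self _ _)])
      (fun x hx => hf _ (Finset.mem_insert_of_mem hm) a (Finset.mem_insert_self _ _) x
        hx.1.le hx.2.le)
    have hlt : ∀ y ∈ t, ∃ x ∈ s, y < x ∧ x < c := fun y hy => by
      obtain ⟨-, -, x, hx, hyx⟩ := ht2 y hy
      exact ⟨x, hx, hyx, (s.le_max' x hx).trans_lt hc1⟩
    have hct : c ∉ t := fun h => by
      obtain ⟨x, -, h1, h2⟩ := hlt c h
      exact lt_asymm h1 h2
    refine ⟨insert c t, ?_, ?_, ?_⟩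
    · rw [Finset.card_insert_of_notMem hct, Finset.card_insert_of_notMem has, ht1]
    · intro y hy
      rcases Finset.mem_insert.1 hy with rfl | hy
      · exact ⟨hc', ⟨_, Finset.mem_insert_of_mem hm, hc1⟩, a, Finset.mem_insert_self _ _, hc2⟩
      · obtain ⟨h1, ⟨x, hx, hxy⟩, x', hx', hyx'⟩ := ht2 y hy
        exact ⟨h1, ⟨x, Finset.mem_insert_of_mem hx, hxy⟩, x', Finset.mem_insert_of_mem hx', hyx'⟩
    · intro u hu v hv huv
      rcases Finset.mem_insert.1 hu with rfl | hu' <;> rcases Finset.mem_insert.1 hv with rfl | hv'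
      · exact absurd huv (lt_irrefl _)
      · obtain ⟨x, -, h1, h2⟩ := hlt v hv'
        exact absurd (huv.trans (h1.trans h2)) (lt_irrefl _)
      · obtain ⟨x, hx, h1, h2⟩ := hlt u hu'
        exact ⟨x, Finset.mem_insert_of_mem hx, h1, h2⟩
      · obtain ⟨x, hx, h1, h2⟩ := ht3 u hu' v hv' huv
        exact ⟨x, Finset.mem_insert_of_mem hx, h1, h2⟩

open Filter Topology in
/-- If moreover `f` tends to `0` at `-∞`, there is one more zero of `f'`, below `s`. -/
lemma exists_finset_deriv_zeros_of_tendsto {f f' : ℝ → ℝ} {s : Finset ℝ} (hs : s.Nonempty)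
    (hf : ∀ b ∈ s, ∀ x ≤ b, HasDerivAt f (f' x) x) (h0 : ∀ x ∈ s, f x = 0)
    (hlim : Tendsto f atBot (𝓝 0)) :
    ∃ t : Finset ℝ, t.card = s.card ∧ (∀ y ∈ t, f' y = 0 ∧ ∃ x ∈ s, y < x) ∧
      ∀ a ∈ t, ∀ b ∈ t, a < b → ∃ v ∈ s, a < v ∧ v < b := by
  obtain ⟨t, ht1, ht2, ht3⟩ := exists_finset_deriv_zeros hs (fun _ _ b hb x _ hx => hf b hb x hx) h0
  have hm := s.min'_mem hs
  obtain ⟨c, hc, hc'⟩ := exists_deriv_zero_of_tendsto_atBot (hf _ hm) (h0 _ hm) hlim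
  have hlt : ∀ y ∈ t, ∃ x ∈ s, c < x ∧ x < y := fun y hy => by
    obtain ⟨-, ⟨x, hx, hxy⟩, -⟩ := ht2 y hy
    exact ⟨x, hx, hc.trans_le (s.min'_le x hx), hxy⟩
  have hct : c ∉ t := fun h => by
    obtain ⟨x, -, h1, h2⟩ := hlt c h
    exact lt_asymm h1 h2
  refine ⟨insert c t, by rw [Finset.card_insert_of_notMem hct, ht1], ?_, ?_⟩
  · intro y hy
    rcases Finset.mem_insert.1 hy with rfl | hy
    · exact ⟨hc', _, hm, hc⟩
    · exact ⟨(ht2 y hy).1, (ht2 y hy).2.2⟩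
  · intro u hu v hv huv
    rcases Finset.mem_insert.1 hu with rfl | hu' <;> rcases Finset.mem_insert.1 hv with rfl | hv'
    · exact absurd huv (lt_irrefl _)
    · exact hlt v hv'
    · obtain ⟨x, -, h1, h2⟩ := hlt u hu'
      exact absurd (huv.trans (h1.trans h2)) (lt_irrefl _)
    · exact ht3 u hu' v hv' huv

/-! ### Zeros of `eˣ p` under the Touchard operator -/

lemma hasDerivAt_exp_mul_eval (p : ℝ[X]) (x : ℝ) :
    HasDerivAt (fun x => Real.exp x * p.eval x) (Real.exp x * (p + derivative p).eval x) x := by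
  have := (Real.hasDerivAt_exp x).mul (p.hasDerivAt x)
  rw [eval_add, mul_add]
  exact this

open Filter Topology in
lemma tendsto_exp_mul_eval_atBot (p : ℝ[X]) :
    Tendsto (fun x => Real.exp x * p.eval x) atBot (𝓝 0) := by
  have h := ((p.comp (-X)).tendsto_div_exp_atTop).comp tendsto_neg_atBot_atTop
  refine h.congr fun x => ?_
  simp [Real.exp_neg, div_eq_mul_inv, mul_comm]

open Filter Topology in
lemma tendsto_rpow_mul_exp_mul_eval_atBot (c : ℝ) (p : ℝ[X]) :
    Tendsto (fun x => (-x) ^ c * (Real.exp x * p.eval x)) atBot (𝓝 0) := by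
  obtain ⟨k, hk⟩ := exists_nat_ge c
  have h := tendsto_exp_mul_eval_atBot (X ^ k * p)
  rw [tendsto_zero_iff_abs_tendsto_zero] at h ⊢
  refine squeeze_zero' (Eventually.of_forall fun x => abs_nonneg _) ?_ h
  filter_upwards [eventually_le_atBot (-1 : ℝ)] with x hx
  have h1 : 1 ≤ -x := by linarith
  have h2 : (-x) ^ c ≤ (-x) ^ k := by
    rw [← Real.rpow_natCast]
    exact Real.rpow_le_rpow_of_exponent_le h1 hk
  have h3 : |x| = -x := abs_of_neg (by linarith)
  simp only [Function.comp_apply, eval_mul, eval_pow, eval_X, abs_mul, abs_pow, h3]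
  rw [abs_of_nonneg (Real.rpow_nonneg (by linarith) c)]
  calc (-x) ^ c * (|Real.exp x| * |p.eval x|) ≤ (-x) ^ k * (|Real.exp x| * |p.eval x|) := by gcongr
    _ = _ := by ring

/-- Applying `T + c` creates a new zero to the left of `b < 0`, provided that at `b` the polynomial
and its image have the same sign. Up to a nonvanishing factor, `(T + c) p` is the derivative of
`(-x)ᶜ eˣ p`, so this is Rolle's theorem with one additional zero before the first zero of `p` and
another one between the last zero and `b`. -/
lemma exists_zeros_touchardOp_add {p : ℝ[X]} {b c : ℝ} {s : Finset ℝ} (hs : s.Nonempty)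
    (hsb : ∀ x ∈ s, x < b ∧ p.eval x = 0) (hb : b < 0)
    (hsign : 0 < p.eval b * (touchardOp p + C c * p).eval b) :
    ∃ t : Finset ℝ, t.card = s.card + 1 ∧
      ∀ x ∈ t, x < b ∧ (touchardOp p + C c * p).eval x = 0 := by
  set q := touchardOp p + C c * p with hq
  set G : ℝ → ℝ := fun x => (-x) ^ c * (Real.exp x * p.eval x) with hG
  set G' : ℝ → ℝ := fun x => -((-x) ^ (c - 1) * Real.exp x * q.eval x) with hG'
  have hder : ∀ x < 0, HasDerivAt G (G' x) x := by
    intro x hx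
    have h1 : HasDerivAt (fun x : ℝ => (-x) ^ c) (-1 * c * (-x) ^ (c - 1)) x :=
      (hasDerivAt_neg x).rpow_const (Or.inl (by linarith))
    convert! h1.mul (hasDerivAt_exp_mul_eval p x) using 1
    have h2 : (-x) ^ c = (-x) ^ (c - 1) * (-x) := by
      rw [← Real.rpow_add_one (by linarith)]; congr 1; ring
    rw [hG', h2, hq, touchardOp_apply]
    simp only [eval_add, eval_mul, eval_X, eval_C]
    ring
  have hzero : ∀ x < 0, G' x = 0 → q.eval x = 0 := by
    intro x hx h
    have h1 : 0 < (-x) ^ (c - 1) * Real.exp x :=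
      mul_pos (Real.rpow_pos_of_pos (by linarith) _) (Real.exp_pos _)
    simpa [hG', h1.ne'] using h
  have hG0 : ∀ x ∈ s, G x = 0 := fun x hx => by simp [hG, (hsb x hx).2]
  obtain ⟨t, ht1, ht2, -⟩ := exists_finset_deriv_zeros_of_tendsto hs
    (fun y hy x hx => hder x (hx.trans_lt ((hsb y hy).1.trans hb))) hG0
    (tendsto_rpow_mul_exp_mul_eval_atBot c p)
  have hm := s.max'_mem hs
  obtain ⟨d, hd1, hd2, hd3⟩ := exists_deriv_zero_of_mul_deriv_neg (hsb _ hm).1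
    (fun x hx => hder x (hx.2.trans_lt hb)) (hG0 _ hm) (by
      have h1 : 0 < (-b) ^ (c - 1) := Real.rpow_pos_of_pos (by linarith) _
      have h2 : 0 < (-b) ^ c := Real.rpow_pos_of_pos (by linarith) _
      have h3 := Real.exp_pos b
      have : G b * G' b = -((-b) ^ (c - 1) * (-b) ^ c * Real.exp b ^ 2 * (p.eval b * q.eval b)) := by
        simp only [hG, hG']; ring
      rw [this]
      exact neg_neg_of_pos (by positivity))
  have hdt : d ∉ t := fun h => by
    obtain ⟨-, x, hx, hdx⟩ := ht2 d h
    exact lt_asymm hd1 (hdx.trans_le (s.le_max' x hx))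
  refine ⟨insert d t, by rw [Finset.card_insert_of_notMem hdt, ht1], ?_⟩
  intro x hx
  rcases Finset.mem_insert.1 hx with rfl | hx
  · exact ⟨hd2, hzero _ (hd2.trans hb) hd3⟩
  · obtain ⟨h1, y, hy, hxy⟩ := ht2 x hx
    have hxb := hxy.trans (hsb y hy).1
    exact ⟨hxb, hzero _ (hxb.trans hb) h1⟩

/-! ### Signs at the test points -/

/-- The base of the test points `± testRadius N ^ m`. It lies strictly between `(N - 1) / N` and
`N / (N + 1)`, which makes `k ↦ k · testRadius N ^ k` maximal exactly at `k = N`. -/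
noncomputable def testRadius (N : ℕ) : ℝ := (2 * N - 1) / (2 * N + 1)

lemma testRadius_pos {N : ℕ} (hN : 1 ≤ N) : 0 < testRadius N := by
  have : (1 : ℝ) ≤ N := by exact_mod_cast hN
  exact div_pos (by linarith) (by linarith)

lemma testRadius_lt_succ (N : ℕ) : testRadius N < testRadius (N + 1) := by
  have : (0 : ℝ) ≤ N := N.cast_nonneg
  rw [testRadius, testRadius, div_lt_div_iff₀ (by linarith) (by positivity)]
  push_cast
  nlinarith

lemma mul_testRadius_pow_lt {N k : ℕ} (hN : 1 ≤ N) (hk : k ≠ N) :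
    k * testRadius N ^ k < N * testRadius N ^ N := by
  have hN' : (1 : ℝ) ≤ N := by exact_mod_cast hN
  have hr := testRadius_pos hN
  rcases lt_or_gt_of_ne hk with h | h
  · obtain ⟨j, rfl⟩ := Nat.exists_eq_add_of_lt h
    rcases Nat.eq_zero_or_pos k with rfl | hk0
    · simpa using mul_pos (by linarith) (pow_pos hr _)
    have h1 : 1 - 1 / ((k + j + 1 : ℕ) : ℝ) < testRadius (k + j + 1) := by
      rw [testRadius, lt_div_iff₀ (by linarith)]
      have : (1 - 1 / ((k + j + 1 : ℕ) : ℝ)) * (2 * ((k + j + 1 : ℕ) : ℝ) + 1) =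
        2 * ((k + j + 1 : ℕ) : ℝ) - 1 - 1 / ((k + j + 1 : ℕ) : ℝ) := by field_simp; ring
      rw [this]
      exact sub_lt_self _ (by positivity)
    have h0 : 0 ≤ 1 - 1 / ((k + j + 1 : ℕ) : ℝ) := by
      rw [sub_nonneg, div_le_one (by linarith)]; exact hN'
    have h2 := one_add_mul_le_pow (a := -(1 / ((k + j + 1 : ℕ) : ℝ)))
      (by linarith) (j + 1)
    rw [← sub_eq_add_neg] at h2
    have h3 := pow_lt_pow_left₀ h1 h0 (Nat.succ_ne_zero j)
    have h4 : (k : ℝ) < ((k + j + 1 : ℕ) : ℝ) * testRadius (k + j + 1) ^ (j + 1) := by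
      refine lt_of_le_of_lt ?_ (mul_lt_mul_of_pos_left (h2.trans_lt h3) (by linarith))
      apply le_of_eq
      push_cast
      field_simp
      ring
    calc (k : ℝ) * testRadius (k + j + 1) ^ k
        < ((k + j + 1 : ℕ) : ℝ) * testRadius (k + j + 1) ^ (j + 1) * testRadius (k + j + 1) ^ k :=
          mul_lt_mul_of_pos_right h4 (pow_pos hr _)
      _ = _ := by rw [mul_assoc, ← pow_add]; congr 2; ring
  · obtain ⟨j, rfl⟩ := Nat.exists_eq_add_of_lt h
    have h1 : testRadius N * (1 + 1 / N) < 1 := by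
      rw [testRadius, div_mul_eq_mul_div, div_lt_one (by linarith)]
      have : (2 * (N : ℝ) - 1) * (1 + 1 / N) = 2 * N + 1 - 1 / N := by field_simp; ring
      rw [this]
      exact sub_lt_self _ (by positivity)
    have h2 := one_add_mul_le_pow (a := 1 / (N : ℝ))
      (by have : 0 ≤ 1 / (N : ℝ) := by positivity
          linarith) (j + 1)
    have h3 : (testRadius N * (1 + 1 / N)) ^ (j + 1) < 1 :=
      pow_lt_one₀ (by positivity) h1 (Nat.succ_ne_zero j)
    rw [mul_pow] at h3
    have h4 : ((N + j + 1 : ℕ) : ℝ) * testRadius N ^ (j + 1) < N := by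
      have h5 : ((N + j + 1 : ℕ) : ℝ) = N * (1 + ((j + 1 : ℕ) : ℝ) * (1 / (N : ℝ))) := by
        push_cast; field_simp; ring
      rw [h5, mul_assoc]
      have h6 := mul_le_mul_of_nonneg_left h2 (pow_pos hr (j + 1)).le
      exact mul_lt_of_lt_one_right (by linarith) (by linarith)
    calc ((N + j + 1 : ℕ) : ℝ) * testRadius N ^ (N + j + 1)
        = ((N + j + 1 : ℕ) : ℝ) * testRadius N ^ (j + 1) * testRadius N ^ N := by
          rw [mul_assoc, ← pow_add]; congr 2; ring
      _ < _ := mul_lt_mul_of_pos_right h4 (pow_pos hr _)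

open Filter Topology in
/-- If `w N` is the strict maximum of `w ≥ 0`, the sum `∑ wₖᵐ bₖ` eventually has the sign of its
term at `N`. -/
lemma eventually_pos_of_dominant {w b : ℕ → ℝ} {N : ℕ} (hw : ∀ k, 0 ≤ w k)
    (hlt : ∀ k, k ≠ N → w k < w N) (hb : Summable fun k => |b k|) (hN : b N ≠ 0) :
    ∀ᶠ m in atTop, 0 < b N * ∑' k, w k ^ m * b k := by
  have hwN : 0 < w N := (hw (N + 1)).trans_lt (hlt _ (by omega))
  have hle : ∀ k, w k / w N ≤ 1 := fun k => by
    rw [div_le_one hwN]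
    rcases eq_or_ne k N with rfl | h
    · exact le_rfl
    · exact (hlt k h).le
  have hlim : Tendsto (fun m => ∑' k, (w k / w N) ^ m * b k) atTop
      (𝓝 (∑' k, if k = N then b N else 0)) := by
    refine tendsto_tsum_of_dominated_convergence hb (fun k => ?_) (Eventually.of_forall fun m k => ?_)
    · split_ifs with h
      · subst h
        simp [div_self hwN.ne']
      · have := (tendsto_pow_atTop_nhds_zero_of_lt_one (div_nonneg (hw k) hwN.le)
          ((div_lt_one hwN).2 (hlt k h))).mul_const (b k)
        rwa [zero_mul] at this
    · rw [Real.norm_eq_abs, abs_mul, abs_pow, abs_of_nonneg (div_nonneg (hw k) hwN.le)]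
      exact mul_le_of_le_one_left (abs_nonneg _)
        (pow_le_one₀ (div_nonneg (hw k) hwN.le) (hle k))
  rw [tsum_ite_eq] at hlim
  have hpos := (hlim.const_mul (b N)).eventually_const_lt (mul_self_pos.2 hN)
  filter_upwards [hpos] with m hm
  have : ∑' k, w k ^ m * b k = w N ^ m * ∑' k, (w k / w N) ^ m * b k := by
    rw [← tsum_mul_left]
    refine tsum_congr fun k => ?_
    rw [div_pow]
    field_simp
  rw [this, mul_left_comm]
  exact mul_pos (pow_pos hwN m) hm

lemma hasSum_touchard (m : ℕ) (Q : ℝ[X]) (x : ℝ) :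
    HasSum (fun k : ℕ => (k : ℝ) ^ m * Q.eval (k : ℝ) * (x ^ k / k.factorial))
      (Real.exp x * (touchard (X ^ m * Q)).eval x) := by
  convert! hasSum_expCoeff (touchard (X ^ m * Q)) x using 3 with k
  rw [expCoeff_touchard, eval_mul, eval_pow, eval_X]

open Filter in
/-- At `± testRadius N ^ m` the term with index `N` dominates the series `∑ kᵐ Q(k) xᵏ / k!`. -/
lemma eventually_sign_touchard {N : ℕ} (hN : 1 ≤ N) (Q : ℝ[X]) (hQ : Q.eval (N : ℝ) ≠ 0) {σ : ℝ}
    (hσ : σ ≠ 0) :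
    ∀ᶠ m in atTop,
      0 < σ ^ N * Q.eval (N : ℝ) * (touchard (X ^ m * Q)).eval (σ * testRadius N ^ m) := by
  have hr := testRadius_pos hN
  have hb : Summable fun k : ℕ => |Q.eval (k : ℝ) * (σ ^ k / k.factorial)| := by
    simpa using (hasSum_touchard 0 Q σ).summable.abs
  have h := eventually_pos_of_dominant (N := N) (w := fun k : ℕ => k * testRadius N ^ k)
    (fun k => by positivity) (fun k hk => mul_testRadius_pow_lt hN hk) hb
    (mul_ne_zero hQ (div_ne_zero (pow_ne_zero _ hσ) (by positivity)))
  filter_upwards [h] with m hm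
  have h1 : ∑' k : ℕ, ((k : ℝ) * testRadius N ^ k) ^ m * (Q.eval (k : ℝ) * (σ ^ k / k.factorial)) =
      Real.exp (σ * testRadius N ^ m) * (touchard (X ^ m * Q)).eval (σ * testRadius N ^ m) := by
    rw [← (hasSum_touchard m Q _).tsum_eq]
    refine tsum_congr fun k => ?_
    rw [mul_pow, mul_pow, ← pow_mul, ← pow_mul, mul_comm m k]
    ring
  rw [h1] at hm
  have h2 : 0 < Real.exp (σ * testRadius N ^ m) / (N.factorial : ℝ) := by positivity
  refine pos_of_mul_pos_left (lt_of_lt_of_eq hm ?_) h2.le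
  ring

/-! ### Zeros close to the origin -/

open Filter in
/-- For large `m`, the disk of radius `testRadius N ^ m` contains `N` real zeros of
`touchard (X ^ m * Q)`: the origin, and one zero whose modulus is between `testRadius k ^ m` and
`testRadius (k + 1) ^ m` for every `1 ≤ k < N`, on the side where the signs at the test points
differ. -/
lemma eventually_exists_inner_zeros {N : ℕ} (hN : 1 ≤ N) (Q : ℝ[X])
    (hQ : ∀ k : ℕ, 1 ≤ k → Q.eval (k : ℝ) ≠ 0) :
    ∀ᶠ m in atTop, ∃ s : Finset ℝ, s.card = N ∧
      ∀ x ∈ s, |x| < testRadius N ^ m ∧ (touchard (X ^ m * Q)).eval x = 0 := by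
  induction N, hN using Nat.le_induction with
  | base =>
    filter_upwards [eventually_ne_atTop 0] with m hm
    refine ⟨{0}, by simp, fun x hx => ?_⟩
    rw [Finset.mem_singleton.1 hx, abs_zero]
    exact ⟨pow_pos (testRadius_pos le_rfl) m, touchard_X_pow_eval_zero m hm Q⟩
  | succ N hN ih =>
    obtain ⟨σ, hσ1, hσ2⟩ : ∃ σ : ℝ, (σ = 1 ∨ σ = -1) ∧
        σ * (Q.eval (N : ℝ) * Q.eval ((N + 1 : ℕ) : ℝ)) < 0 := by
      rcases lt_or_gt_of_ne (mul_ne_zero (hQ N hN) (hQ (N + 1) (by omega))) with h | h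
      · exact ⟨1, Or.inl rfl, by linarith⟩
      · exact ⟨-1, Or.inr rfl, by linarith⟩
    have hσ0 : σ ≠ 0 := by rcases hσ1 with rfl | rfl <;> norm_num
    have hσabs : |σ| = 1 := by rcases hσ1 with rfl | rfl <;> simp
    filter_upwards [ih, eventually_ne_atTop 0,
      eventually_sign_touchard hN Q (hQ N hN) hσ0,
      eventually_sign_touchard (N := N + 1) (by omega) Q (hQ (N + 1) (by omega)) hσ0]
      with m ⟨s, hs1, hs2⟩ hm h1 h2
    have hlt : testRadius N ^ m < testRadius (N + 1) ^ m :=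
      pow_lt_pow_left₀ (testRadius_lt_succ N) (testRadius_pos hN).le hm
    set p := touchard (X ^ m * Q)
    have h3 : p.eval (σ * testRadius N ^ m) * p.eval (σ * testRadius (N + 1) ^ m) < 0 := by
      have h4 := mul_pos h1 h2
      have h5 : 0 < σ ^ (2 * N) := by
        rw [pow_mul]; positivity
      by_contra! h6
      have := mul_nonpos_of_nonneg_of_nonpos (mul_nonneg h5.le h6) hσ2.le
      refine absurd (h4.trans_le (le_trans (le_of_eq ?_) this)) (lt_irrefl _)
      ring
    obtain ⟨y, hy1, hy2⟩ : ∃ y ∈ Set.Ioo (testRadius N ^ m) (testRadius (N + 1) ^ m),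
        p.eval (σ * y) = 0 := by
      have hc : ContinuousOn (fun y => p.eval (σ * y))
          (Set.Icc (testRadius N ^ m) (testRadius (N + 1) ^ m)) := by fun_prop
      rcases mul_neg_iff.1 h3 with ⟨ha, hb⟩ | ⟨ha, hb⟩
      · exact intermediate_value_Ioo' hlt.le hc ⟨hb, ha⟩
      · exact intermediate_value_Ioo hlt.le hc ⟨ha, hb⟩
    have habs : |σ * y| = y := by
      rw [abs_mul, hσabs, one_mul, abs_of_pos ((pow_pos (testRadius_pos hN) m).trans hy1.1)]
    have hys : σ * y ∉ s := fun h => by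
      have := (hs2 _ h).1
      rw [habs] at this
      exact lt_asymm this hy1.1
    refine ⟨insert (σ * y) s, by rw [Finset.card_insert_of_notMem hys, hs1], fun x hx => ?_⟩
    rcases Finset.mem_insert.1 hx with rfl | hx
    · exact ⟨habs.trans_lt hy1.2, hy2⟩
    · exact ⟨(hs2 x hx).1.trans hlt, (hs2 x hx).2⟩

/-! ### Zeros far from the origin -/

lemma exists_zeros_touchard_X_pow (m : ℕ) :
    ∃ s : Finset ℝ, s.card = m ∧ ∀ x ∈ s, x ≤ 0 ∧ (touchard (X ^ m * 1)).eval x = 0 := by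
  induction m with
  | zero => exact ⟨∅, by simp⟩
  | succ m ih =>
    obtain ⟨s, hs1, hs2⟩ := ih
    obtain ⟨t, ht1, ht2⟩ : ∃ t : Finset ℝ, t.card = m ∧
        ∀ x ∈ t, x < 0 ∧ (touchard (X ^ (m + 1) * 1)).eval x = 0 := by
      rcases s.eq_empty_or_nonempty with rfl | hs
      · exact ⟨∅, by simpa using hs1⟩
      obtain ⟨t, ht1, ht2, -⟩ := exists_finset_deriv_zeros_of_tendsto hs
        (fun b _ x _ => hasDerivAt_exp_mul_eval (touchard (X ^ m * 1)) x)
        (fun x hx => by rw [(hs2 x hx).2, mul_zero]) (tendsto_exp_mul_eval_atBot _)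
      refine ⟨t, ht1.trans hs1, fun y hy => ?_⟩
      obtain ⟨h1, x, hx, hyx⟩ := ht2 y hy
      refine ⟨hyx.trans_le (hs2 x hx).1, ?_⟩
      rw [touchard_X_pow_succ_mul, touchardOp_apply, eval_mul,
        (mul_eq_zero.1 h1).resolve_left (Real.exp_pos y).ne', mul_zero]
    have h0 : (0 : ℝ) ∉ t := fun h => lt_irrefl _ (ht2 0 h).1
    refine ⟨insert 0 t, by rw [Finset.card_insert_of_notMem h0, ht1], fun x hx => ?_⟩
    rcases Finset.mem_insert.1 hx with rfl | hx
    · exact ⟨le_rfl, touchard_X_pow_eval_zero _ (by omega) _⟩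
    · exact ⟨(ht2 x hx).1.le, (ht2 x hx).2⟩

/-- A bound for the number of zeros of `p` in terms of the `N`-th derivative of `eˣ p`. -/
lemma card_zeros_le {a b : ℝ} (N : ℕ) {p : ℝ[X]} {s : Finset ℝ}
    (h : ∀ x, a ≤ x → x ≤ b → ((fun q : ℝ[X] => q + derivative q)^[N] p).eval x ≠ 0)
    (hs : ∀ x ∈ s, a ≤ x ∧ x ≤ b ∧ p.eval x = 0) : s.card ≤ N := by
  induction N generalizing p s with
  | zero =>
    rcases s.eq_empty_or_nonempty with rfl | ⟨x, hx⟩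
    · simp
    · exact absurd (hs x hx).2.2 (h x (hs x hx).1 (hs x hx).2.1)
  | succ N ih =>
    rcases s.eq_empty_or_nonempty with rfl | hne
    · simp
    obtain ⟨t, ht1, ht2, -⟩ := exists_finset_deriv_zeros hne
      (fun _ _ _ _ x _ _ => hasDerivAt_exp_mul_eval p x)
      (fun x hx => by rw [(hs x hx).2.2, mul_zero])
    have := ih (p := p + derivative p) (s := t) h fun y hy => by
      obtain ⟨h1, ⟨x, hx, hxy⟩, x', hx', hyx'⟩ := ht2 y hy
      exact ⟨(hs x hx).1.trans hxy.le, hyx'.le.trans (hs x' hx').2.1,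
        (mul_eq_zero.1 h1).resolve_left (Real.exp_pos y).ne'⟩
    omega

lemma expCoeff_iterate (N k : ℕ) (p : ℝ[X]) :
    expCoeff k ((fun q : ℝ[X] => q + derivative q)^[N] p) = expCoeff (k + N) p := by
  induction N generalizing k with
  | zero => rfl
  | succ N ih => rw [Function.iterate_succ_apply', expCoeff_add_derivative, ih, add_assoc, add_comm 1 N]

open Filter in
/-- The `N`-th derivative `∑ (k + N)ᵐ xᵏ / k!` of `eˣ · touchard (X ^ m)` is dominated by its constant
term for `|x| ≤ testRadius N ^ m`. -/
lemma eventually_iterate_touchard_pos {N : ℕ} (hN : 1 ≤ N) :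
    ∀ᶠ m in atTop, ∀ x, |x| ≤ testRadius N ^ m →
      0 < ((fun q : ℝ[X] => q + derivative q)^[N] (touchard (X ^ m * 1))).eval x := by
  have hr := testRadius_pos hN
  set b : ℕ → ℝ := fun k => if k = 0 then 1 else -(1 / k.factorial) with hb
  have hbabs : ∀ k, |b k| = 1 ^ k / k.factorial := fun k => by
    simp only [hb]
    split_ifs with h
    · simp [h]
    · rw [abs_neg, abs_of_pos (by positivity), one_pow]
  have hsum : Summable fun k => |b k| := by
    simp only [hbabs]
    exact Real.summable_pow_div_factorial 1
  have hlt : ∀ k : ℕ, k ≠ 0 →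
      ((k + N : ℕ) : ℝ) * testRadius N ^ k < ((0 + N : ℕ) : ℝ) * testRadius N ^ 0 := fun k hk => by
    have h1 := mul_testRadius_pow_lt (k := k + N) hN (by omega)
    rw [pow_add, ← mul_assoc] at h1
    simpa using lt_of_mul_lt_mul_right h1 (pow_pos hr N).le
  filter_upwards [eventually_pos_of_dominant (N := 0) (fun k => by positivity) hlt hsum
    (by simp [hb])] with m hm x hx
  have h0 : b 0 = 1 := if_pos rfl
  rw [h0, one_mul] at hm
  have h1 := hasSum_expCoeff ((fun q : ℝ[X] => q + derivative q)^[N] (touchard (X ^ m * 1))) x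
  simp only [expCoeff_iterate, expCoeff_touchard, eval_pow, eval_X, mul_one] at h1 ⊢
  -- a series with positive sum is summable
  have h2 : Summable fun k => (((k + N : ℕ) : ℝ) * testRadius N ^ k) ^ m * b k := by
    by_contra h
    rw [tsum_eq_zero_of_not_summable h] at hm
    exact lt_irrefl _ hm
  refine pos_of_mul_pos_right (hm.trans_le (hasSum_le (fun k => ?_) h2.hasSum h1))
    (Real.exp_pos x).le
  rw [mul_pow, mul_assoc]
  refine mul_le_mul_of_nonneg_left ?_ (by positivity)
  rcases eq_or_ne k 0 with rfl | hk
  · simp [hb]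
  · have h3 : |x ^ k| ≤ (testRadius N ^ k) ^ m := by
      rw [abs_pow, ← pow_mul, mul_comm k m, pow_mul]
      exact pow_le_pow_left₀ (abs_nonneg x) hx k
    have h4 := (abs_le.1 h3).1
    simp only [hb, if_neg hk]
    rw [mul_neg, mul_one_div, ← neg_div]
    gcongr

open Filter in
/-- For large `m`, the polynomial `touchard (X ^ m * ∏ (X + φᵢ))`, of degree `m + d`, has at least
`m + d - N` distinct zeros smaller than `- testRadius N ^ m`. For the empty product this holds because the Bell polynomials are
real-rooted; a further factor `X + φᵢ` creates one more such zero, because the sign at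
`- testRadius N ^ m` does not change. -/
lemma eventually_exists_outer_zeros {φ : ℕ → ℝ} {N : ℕ} (hN : 1 ≤ N)
    (hφ : ∀ i, 1 ≤ i → 0 < N + φ i) (d : ℕ) :
    ∀ᶠ m in atTop, ∃ s : Finset ℝ, m + d ≤ s.card + N ∧ ∀ x ∈ s, x < -testRadius N ^ m ∧
      (touchard (X ^ m * ∏ i ∈ Finset.Icc 1 d, (X + C (φ i)))).eval x = 0 := by
  have hQ : ∀ d, 0 < (∏ i ∈ Finset.Icc 1 d, (X + C (φ i))).eval (N : ℝ) := fun d => by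
    rw [eval_prod]
    exact Finset.prod_pos fun i hi => by simpa using hφ i (Finset.mem_Icc.1 hi).1
  induction d with
  | zero =>
    filter_upwards [eventually_iterate_touchard_pos hN] with m hm
    obtain ⟨s, hs1, hs2⟩ := exists_zeros_touchard_X_pow m
    refine ⟨s.filter fun x => x < -testRadius N ^ m, ?_, fun x hx => ?_⟩
    · have h1 : (s.filter fun x => ¬ x < -testRadius N ^ m).card ≤ N := by
        refine card_zeros_le (a := -testRadius N ^ m) (b := 0) N (p := touchard (X ^ m * 1))
          (fun x hx hx' => (hm x (abs_le.2 ⟨hx, hx'.trans ?_⟩)).ne') fun x hx => ?_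
        · exact (pow_pos (testRadius_pos hN) m).le
        · rw [Finset.mem_filter, not_lt] at hx
          exact ⟨hx.2, hs2 x hx.1⟩
      have h2 := s.card_filter_add_card_filter_not fun x => x < -testRadius N ^ m
      omega
    · rw [Finset.mem_filter] at hx
      exact ⟨hx.2, by simpa using (hs2 x hx.1).2⟩
  | succ d ih =>
    filter_upwards [ih, eventually_gt_atTop N,
      eventually_sign_touchard hN _ (hQ d).ne' (neg_ne_zero.2 one_ne_zero),
      eventually_sign_touchard hN _ (hQ (d + 1)).ne' (neg_ne_zero.2 one_ne_zero)]
      with m ⟨s, hs1, hs2⟩ hm h1 h2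
    rw [Finset.prod_Icc_succ_top (by omega), ← mul_assoc, touchard_mul_X_add_C] at h2 ⊢
    rw [neg_one_mul] at h1 h2
    have hs : s.Nonempty := Finset.card_pos.1 (by omega)
    obtain ⟨t, ht1, ht2⟩ := exists_zeros_touchardOp_add hs hs2
      (neg_lt_zero.2 (pow_pos (testRadius_pos hN) m)) (c := φ (d + 1)) (by
        have h3 := mul_pos h1 h2
        have h4 := mul_pos (hQ d) (hQ (d + 1))
        rw [Finset.prod_Icc_succ_top (by omega)] at h4
        have h5 : ((-1 : ℝ) ^ N) * (-1) ^ N = 1 := by rw [← mul_pow]; simp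
        have h6 : ∀ ε A x B y : ℝ, ε * A * x * (ε * B * y) = ε * ε * (A * B * (x * y)) :=
          fun _ _ _ _ _ => by ring
        rw [h6, h5, one_mul] at h3
        exact pos_of_mul_pos_right h3 h4.le)
    exact ⟨t, by omega, ht2⟩

/-! ### Real-rootedness -/

open Filter in
/-- The zeros close to the origin and those far from it exhaust the degree. -/
lemma eventually_card_roots_touchard (φ : ℕ → ℝ) (K : ℕ)
    (hzero : ∀ i : ℕ, K + 1 ≤ i → φ i = 0)
    (hneg : ∀ i : ℕ, 1 ≤ i → i ≤ K → ∀ m : ℕ, 1 ≤ m → φ i ≠ -(m : ℝ)) :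
    ∀ᶠ m in atTop, m + K ≤
      (touchard (X ^ m * ∏ i ∈ Finset.Icc 1 K, (X + C (φ i)))).roots.toFinset.card := by
  obtain ⟨N, hN, hφ⟩ : ∃ N : ℕ, 1 ≤ N ∧ ∀ i, 1 ≤ i → 0 < N + φ i := by
    obtain ⟨N, hN⟩ := exists_nat_gt (∑ i ∈ Finset.Icc 1 K, |φ i|)
    have h0 : (0 : ℝ) < N := (Finset.sum_nonneg fun i _ => abs_nonneg (φ i)).trans_lt hN
    refine ⟨N, by exact_mod_cast h0, fun i hi => ?_⟩
    rcases le_or_gt i K with h | h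
    · have := Finset.single_le_sum (fun i _ => abs_nonneg (φ i)) (Finset.mem_Icc.2 ⟨hi, h⟩)
      linarith [neg_abs_le (φ i)]
    · rw [hzero i h, add_zero]
      exact h0
  have hQ : ∀ k : ℕ, 1 ≤ k → (∏ i ∈ Finset.Icc 1 K, (X + C (φ i))).eval (k : ℝ) ≠ 0 := by
    intro k hk
    rw [eval_prod, Finset.prod_ne_zero_iff]
    intro i hi h
    rw [Finset.mem_Icc] at hi
    simp only [eval_add, eval_X, eval_C] at h
    exact hneg i hi.1 hi.2 k hk (by linarith)
  filter_upwards [eventually_exists_inner_zeros hN _ hQ, eventually_exists_outer_zeros hN hφ K]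
    with m ⟨s, hs1, hs2⟩ ⟨t, ht1, ht2⟩
  have hne := (monic_touchard_X_pow_mul (monic_touchard_prod φ K) m).1.ne_zero
  have hdisj : Disjoint s t := Finset.disjoint_left.2 fun x hx hx' => by
    linarith [(hs2 x hx).1, (ht2 x hx').1, neg_abs_le x]
  have hsub : s ∪ t ⊆
      (touchard (X ^ m * ∏ i ∈ Finset.Icc 1 K, (X + C (φ i)))).roots.toFinset := fun x hx => by
    rw [Multiset.mem_toFinset, mem_roots hne]
    rcases Finset.mem_union.1 hx with h | h
    · exact (hs2 x h).2
    · exact (ht2 x h).2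
  have := Finset.card_le_card hsub
  rw [Finset.card_union_of_disjoint hdisj] at this
  omega

lemma realSimpleZeros_of_card {p : ℝ[X]} (hp : p.Monic)
    (h : p.natDegree ≤ p.roots.toFinset.card) : RealSimpleZeros p := by
  have h1 : p.roots.card = p.natDegree :=
    le_antisymm (card_roots' p) (h.trans (Multiset.toFinset_card_le _))
  have hnodup : p.roots.Nodup := Multiset.dedup_card_eq_card_iff_nodup.1
    (le_antisymm (Multiset.card_le_card (Multiset.dedup_le _)) (h1.trans_le h))
  have hprod := prod_multiset_X_sub_C_of_monic_of_roots_card_eq hp h1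
  have hmap : (p.map (algebraMap ℝ ℂ)).roots = p.roots.map (algebraMap ℝ ℂ) := by
    conv_lhs => rw [← hprod]
    rw [Polynomial.map_multiset_prod, Multiset.map_map]
    simp only [Function.comp_def, Polynomial.map_sub, map_X, map_C]
    rw [← roots_multiset_prod_X_sub_C (p.roots.map (algebraMap ℝ ℂ)), Multiset.map_map]
    rfl
  intro z hz
  have hz' : z ∈ (p.map (algebraMap ℝ ℂ)).roots :=
    (mem_roots (hp.map _).ne_zero).2 hz
  refine ⟨?_, ?_⟩
  · rw [hmap, Multiset.mem_map] at hz'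
    obtain ⟨a, -, rfl⟩ := hz'
    simp
  · rw [← count_roots]
    refine Multiset.count_eq_one_of_mem ?_ hz'
    rw [hmap]
    exact hnodup.map (algebraMap ℝ ℂ).injective

/-! ### Interlacing -/

lemma mem_negZeros {p : ℝ[X]} (hp : p ≠ 0) {x : ℝ} : x ∈ negZeros p ↔ p.eval x = 0 ∧ x < 0 := by
  rw [negZeros, Finset.mem_filter, Multiset.mem_toFinset, mem_roots hp, IsRoot.def]

lemma mem_posZeros {p : ℝ[X]} (hp : p ≠ 0) {x : ℝ} : x ∈ posZeros p ↔ p.eval x = 0 ∧ 0 < x := by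
  rw [posZeros, Finset.mem_filter, Multiset.mem_toFinset, mem_roots hp, IsRoot.def]

lemma card_negZeros_add_card_posZeros {p : ℝ[X]} (hp : p ≠ 0) (h0 : p.eval 0 = 0) :
    (negZeros p).card + (posZeros p).card + 1 = p.roots.toFinset.card := by
  have h : p.roots.toFinset = insert 0 (negZeros p ∪ posZeros p) := by
    ext x
    rw [Multiset.mem_toFinset, mem_roots hp, Finset.mem_insert, Finset.mem_union, mem_negZeros hp,
      mem_posZeros hp, IsRoot.def]
    constructor
    · intro h
      rcases lt_trichotomy x 0 with hx | hx | hx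
      · exact Or.inr (Or.inl ⟨h, hx⟩)
      · exact Or.inl hx
      · exact Or.inr (Or.inr ⟨h, hx⟩)
    · rintro (rfl | h | h)
      exacts [h0, h.1, h.1]
  rw [h, Finset.card_insert_of_notMem, Finset.card_union_of_disjoint]
  · refine Finset.disjoint_left.2 fun x hx hx' => ?_
    exact lt_asymm ((mem_negZeros hp).1 hx).2 ((mem_posZeros hp).1 hx').2
  · rw [Finset.mem_union, mem_negZeros hp, mem_posZeros hp]
    simp

lemma exists_touchardOp_zero_between {p : ℝ[X]} {v w : ℝ} (hvw : v < w) (hv : p.eval v = 0)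
    (hw : p.eval w = 0) : ∃ c, v < c ∧ c < w ∧ (touchardOp p).eval c = 0 := by
  obtain ⟨c, hc, hc'⟩ := exists_hasDerivAt_eq_zero hvw
    (fun x _ => (hasDerivAt_exp_mul_eval p x).continuousAt.continuousWithinAt)
    (by rw [hv, hw, mul_zero, mul_zero]) (fun x _ => hasDerivAt_exp_mul_eval p x)
  refine ⟨c, hc.1, hc.2, ?_⟩
  rw [touchardOp_apply, eval_mul, (mul_eq_zero.1 hc').resolve_left (Real.exp_pos c).ne', mul_zero]

/-- Rolle's theorem produces `|V₋| + 1` negative and `|V₊|` positive zeros of `T p`, where `V₋` and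
`V₊` are the sets of negative and positive zeros of `p`. With the origin these are already
`deg p + 1` zeros, so there are no others. Here `p` is assumed to have `deg p` distinct real zeros, one
of them at the origin. -/
lemma interlaces_touchardOp {p : ℝ[X]} (hp : p.Monic) (h0 : p.eval 0 = 0)
    (h : p.natDegree ≤ p.roots.toFinset.card) :
    Interlaces (negZeros (touchardOp p)) (negZeros p) ∧
      Interlaces (posZeros (touchardOp p)) (posZeros p) := by
  have hp0 := hp.ne_zero
  obtain ⟨hqm, hqd⟩ : (touchardOp p).Monic ∧ (touchardOp p).natDegree = p.natDegree + 1 := by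
    simpa using monic_touchardOp_add hp 0
  have hq0 := hqm.ne_zero
  have hq00 : (touchardOp p).eval 0 = 0 := by simp [touchardOp_apply]
  have hcard := card_negZeros_add_card_posZeros hp0 h0
  have hcard' := card_negZeros_add_card_posZeros hq0 hq00
  have hle : (touchardOp p).roots.toFinset.card ≤ p.natDegree + 1 :=
    hqd ▸ (Multiset.toFinset_card_le _).trans (card_roots' _)
  have hcrit : ∀ y, Real.exp y * (p + derivative p).eval y = 0 → (touchardOp p).eval y = 0 :=
    fun y hy => by
      rw [touchardOp_apply, eval_mul, (mul_eq_zero.1 hy).resolve_left (Real.exp_pos y).ne',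
        mul_zero]
  have hn0 : (0 : ℝ) ∉ negZeros p := by simp [mem_negZeros hp0]
  have hp0' : (0 : ℝ) ∉ posZeros p := by simp [mem_posZeros hp0]
  have hzn : ∀ x ∈ insert 0 (negZeros p), p.eval x = 0 ∧ x ≤ 0 := fun x hx => by
    rcases Finset.mem_insert.1 hx with rfl | hx
    · exact ⟨h0, le_rfl⟩
    · exact ⟨((mem_negZeros hp0).1 hx).1, ((mem_negZeros hp0).1 hx).2.le⟩
  have hzp : ∀ x ∈ insert 0 (posZeros p), p.eval x = 0 ∧ 0 ≤ x := fun x hx => by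
    rcases Finset.mem_insert.1 hx with rfl | hx
    · exact ⟨h0, le_rfl⟩
    · exact ⟨((mem_posZeros hp0).1 hx).1, ((mem_posZeros hp0).1 hx).2.le⟩
  obtain ⟨s, hs1, hs2, hs3⟩ := exists_finset_deriv_zeros_of_tendsto
    (Finset.insert_nonempty 0 (negZeros p)) (fun _ _ x _ => hasDerivAt_exp_mul_eval p x)
    (fun x hx => by rw [(hzn x hx).1, mul_zero]) (tendsto_exp_mul_eval_atBot p)
  obtain ⟨t, ht1, ht2, ht3⟩ := exists_finset_deriv_zeros
    (Finset.insert_nonempty 0 (posZeros p)) (fun _ _ _ _ x _ _ => hasDerivAt_exp_mul_eval p x)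
    (fun x hx => by rw [(hzp x hx).1, mul_zero])
  rw [Finset.card_insert_of_notMem hn0] at hs1
  rw [Finset.card_insert_of_notMem hp0'] at ht1
  have hsU : s ⊆ negZeros (touchardOp p) := fun y hy => by
    obtain ⟨h1, x, hx, hyx⟩ := hs2 y hy
    exact (mem_negZeros hq0).2 ⟨hcrit y h1, hyx.trans_le (hzn x hx).2⟩
  have htU : t ⊆ posZeros (touchardOp p) := fun y hy => by
    obtain ⟨h1, ⟨x, hx, hxy⟩, -⟩ := ht2 y hy
    exact (mem_posZeros hq0).2 ⟨hcrit y h1, (hzp x hx).2.trans_lt hxy⟩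
  have hsle := Finset.card_le_card hsU
  have htle := Finset.card_le_card htU
  have hs := Finset.eq_of_subset_of_card_le hsU (by omega)
  have ht := Finset.eq_of_subset_of_card_le htU (by omega)
  rw [← hs, ← ht]
  refine ⟨⟨fun a ha b hb hab hcons => ?_, Or.inl hs1⟩,
    ⟨fun a ha b hb hab hcons => ?_, Or.inr ⟨by omega, ?_⟩⟩⟩
  · have hb0 : b < 0 := ((mem_negZeros hq0).1 (hsU hb)).2
    obtain ⟨v, hv, hav, hvb⟩ := hs3 a ha b hb hab
    have huniq : ∀ x y, x ∈ negZeros p → y ∈ negZeros p → a < x → y < b → ¬ x < y := by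
      intro x y hx hy hax hyb hxy
      obtain ⟨c, hc1, hc2, hc3⟩ := exists_touchardOp_zero_between hxy ((mem_negZeros hp0).1 hx).1
        ((mem_negZeros hp0).1 hy).1
      refine hcons c ?_ ⟨hax.trans hc1, hc2.trans hyb⟩
      rw [hs]
      exact (mem_negZeros hq0).2 ⟨hc3, (hc2.trans hyb).trans hb0⟩
    have hvV : v ∈ negZeros p := (mem_negZeros hp0).2 ⟨(hzn v hv).1, hvb.trans hb0⟩
    exact ⟨v, ⟨hvV, hav, hvb⟩, fun w hw => le_antisymm (not_lt.1 (huniq v w hvV hw.1 hav hw.2.2))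
      (not_lt.1 (huniq w v hw.1 hvV hw.2.1 hvb))⟩
  · have ha0 : 0 < a := ((mem_posZeros hq0).1 (htU ha)).2
    obtain ⟨v, hv, hav, hvb⟩ := ht3 a ha b hb hab
    have huniq : ∀ x y, x ∈ posZeros p → y ∈ posZeros p → a < x → y < b → ¬ x < y := by
      intro x y hx hy hax hyb hxy
      obtain ⟨c, hc1, hc2, hc3⟩ := exists_touchardOp_zero_between hxy ((mem_posZeros hp0).1 hx).1
        ((mem_posZeros hp0).1 hy).1
      refine hcons c ?_ ⟨hax.trans hc1, hc2.trans hyb⟩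
      rw [ht]
      exact (mem_posZeros hq0).2 ⟨hc3, ha0.trans (hax.trans hc1)⟩
    have hvV : v ∈ posZeros p := (mem_posZeros hp0).2 ⟨(hzp v hv).1, ha0.trans hav⟩
    exact ⟨v, ⟨hvV, hav, hvb⟩, fun w hw => le_antisymm (not_lt.1 (huniq v w hvV hw.1 hav hw.2.2))
      (not_lt.1 (huniq w v hw.1 hvV hw.2.1 hvb))⟩
  · intro hU hV
    have hm := t.max'_mem hU
    obtain ⟨-, -, x, hx, hlt⟩ := ht2 _ hm
    have hx0 : 0 < x := ((mem_posZeros hq0).1 (htU hm)).2.trans hlt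
    exact hlt.trans_le (Finset.le_max' _ x ((mem_posZeros hp0).2 ⟨(hzp x hx).1, hx0⟩))

theorem theorem4 (φ : ℕ → ℝ) (K : ℕ)
    (hzero : ∀ i : ℕ, K + 1 ≤ i → φ i = 0)
    (hneg : ∀ i : ℕ, 1 ≤ i → i ≤ K → ∀ m : ℕ, 1 ≤ m → φ i ≠ -(m : ℝ)) :
    ∃ n₀ : ℕ, ∀ n : ℕ, n₀ ≤ n →
      RealSimpleZeros (genBellPoly φ n) ∧
      Interlaces (negZeros (genBellPoly φ (n + 1))) (negZeros (genBellPoly φ n)) ∧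
      Interlaces (posZeros (genBellPoly φ (n + 1))) (posZeros (genBellPoly φ n)) := by
  obtain ⟨m₀, hm₀⟩ := Filter.eventually_atTop.1 (eventually_card_roots_touchard φ K hzero hneg)
  refine ⟨K + m₀ + 1, fun n hn => ?_⟩
  obtain ⟨m, rfl⟩ := Nat.exists_eq_add_of_le (show K ≤ n by omega)
  obtain ⟨hmonic, hdeg⟩ := monic_touchard_X_pow_mul (monic_touchard_prod φ K) m
  have hcard := hm₀ m (by omega)
  rw [← hdeg] at hcard
  rw [add_assoc, genBellPoly_add φ K m hzero, genBellPoly_add φ K (m + 1) hzero,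
    touchard_X_pow_succ_mul]
  exact ⟨realSimpleZeros_of_card hmonic hcard,
    interlaces_touchardOp hmonic (touchard_X_pow_eval_zero m (by omega) _) hcard⟩
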